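/- All spaces are real. For normed spaces $X,Y$ let $\mathbb L(X,Y)$ be the space of bounded linear operators from $X$ to $Y$ with the operator norm, and for $A\in\mathbb L(X,Y)$ let $M_A=\{x\in X:\|x\|=1,\ \|Ax\|=\|A\|\}$ be its norm attainment set. Let $\epsilon>0$ and let $T,A\in\mathbb L(X,Y)$ with $\|T\|=\|A\|=1$. We say that $A$ is a uniform $\epsilon$-BPB approximation of $T$ if there exists $\delta>0$ such that for every $x_0\in X$ with $\|x_0\|=1$ and $\|Tx_0\|>1-\delta$ there exists $u_0\in M_A$ with $\|u_0-x_0\|<\epsilon$ and $\|T-A\|<\epsilon$; it is called non-trivial if $A\neq T$. The pair $(X,Y)$ has the non-trivial norm preserving uniform BPB approximation property if for every $T\in\mathbb L(X,Y)$ with $\|T\|=1$ that is not an isometry and every $\epsilon>0$ there is a non-trivial uniform $\epsilon$-BPB approximation $A_\epsilon$ of $T$ with $M_{A_\epsilon}=M_T$. Let $n\in\mathbb N$ and let $\ell_1^n$ be $\mathbb R^n$ with the norm $\|x\|=\sum_{i=1}^n|x_i|$. Let $T\in\mathbb L(\ell_1^n,\ell_1^n)$ with $\|T\|=1$. Then $T$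 is an isometry if and only if there exists $\epsilon_0>0$ such that for every $0<\epsilon<\epsilon_0$ the operator $T$ is the only uniform $\epsilon$-BPB approximation of $T$. Moreover, the pair $(\ell_1^n,\ell_1^n)$ has the non-trivial norm preserving uniform BPB approximation property. -/

import Mathlib

namespace BPB

variable {X Y : Type*} [NormedAddCommGroup X] [NormedSpace ℝ X]
  [NormedAddCommGroup Y] [NormedSpace ℝ Y]

/-- The norm attainment set `M_T` of a bounded linear operator. -/
def normAttainSet (T : X →L[ℝ] Y) : Set X :=
  {x | ‖x‖ = 1 ∧ ‖T x‖ = ‖T‖}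

/-- `A` is a uniform `ε`-BPB approximation of `T`; both operators have norm one. -/
def IsUniformApprox (ε : ℝ) (T A : X →L[ℝ] Y) : Prop :=
  ‖T‖ = 1 ∧ ‖A‖ = 1 ∧
    ∃ δ : ℝ, 0 < δ ∧ ∀ x₀ : X, ‖x₀‖ = 1 → 1 - δ < ‖T x₀‖ →
      ∃ u₀ ∈ normAttainSet A, ‖u₀ - x₀‖ < ε ∧ ‖T - A‖ < ε

/-- A uniform `ε`-BPB approximation of `T` that differs from `T`. -/
def IsNontrivialUniformApprox (ε : ℝ) (T A : X →L[ℝ] Y) : Prop :=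
  IsUniformApprox ε T A ∧ A ≠ T

/-- `T` is the only uniform `ε`-BPB approximation of `T`. -/
def IsOnlyUniformApprox (ε : ℝ) (T : X →L[ℝ] Y) : Prop :=
  ∀ A : X →L[ℝ] Y, IsUniformApprox ε T A ↔ A = T

variable (X Y) in
/-- The pair `(X, Y)` has the non-trivial norm preserving uniform BPB approximation property. -/
def HasNontrivialNormPreservingApprox : Prop :=
  ∀ T : X →L[ℝ] Y, ‖T‖ = 1 → ¬ Isometry T → ∀ ε : ℝ, 0 < ε →
    ∃ A : X →L[ℝ] Y, IsNontrivialUniformApprox ε T A ∧ normAttainSet T = normAttainSet A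

/-- The real space `ℓ₁ⁿ`: `ℝⁿ` with the norm `∑ |xᵢ|`. -/
abbrev ellOne (n : ℕ) : Type := PiLp 1 (fun _ : Fin n => ℝ)

end BPB

/-! Everything is read off the columns `T e_j`, all of norm at most one. Equality in the triangle
inequality (`mem_normAttainSet_iff`) shows that `M_T` depends only on which columns have norm one
and on the signs of products of two entries of such columns in the same row. By compactness, a norm
one operator close to `T` with the same `M_T` is a uniform approximation of `T`.

If `T` is not an isometry, some column can be moved slightly without altering these data: a column
of norm below one has room; a norm one column that is not a signed unit vector can be moved towards
the unit vector of one of its nonzero entries; and if all columns are signed unit vectors with two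
in the same row, another row is zero and a column can be moved into it.

Conversely, for small `ε`, every uniform approximation of an isometry has integer entries, and two
such operators at distance less than one coincide. -/

namespace BPB

/-! ### Compactness of the unit sphere -/

section FiniteDimensional

variable {X Y : Type*} [NormedAddCommGroup X] [NormedSpace ℝ X]
  [NormedAddCommGroup Y] [NormedSpace ℝ Y]

/-- In finite dimensions, unit vectors at which an operator almost attains its norm are uniformly
close to its norm attainment set. -/
theorem exists_forall_near_normAttainSet [FiniteDimensional ℝ X] (T : X →L[ℝ] Y)
    (hT : ‖T‖ = 1) {ε : ℝ} (hε : 0 < ε) :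
    ∃ δ : ℝ, 0 < δ ∧ ∀ x : X, ‖x‖ = 1 → 1 - δ < ‖T x‖ →
      ∃ u ∈ normAttainSet T, ‖u - x‖ < ε := by
  have : ProperSpace X := FiniteDimensional.proper ℝ X
  set F : Set X := {x | ∀ u ∈ normAttainSet T, ε ≤ ‖u - x‖} with hF
  have hFc : IsClosed F := by
    have : F = ⋂ u ∈ normAttainSet T, {x | ε ≤ ‖u - x‖} := by ext x; simp [hF]
    rw [this]
    exact isClosed_biInter fun u _ => isClosed_le continuous_const (by fun_prop)
  have hK : IsCompact (Metric.sphere (0 : X) 1 ∩ F) := (isCompact_sphere _ _).inter_right hFc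
  rcases (Metric.sphere (0 : X) 1 ∩ F).eq_empty_or_nonempty with he | hne
  · refine ⟨1, one_pos, fun x hx _ => ?_⟩
    by_contra! h
    have : x ∈ Metric.sphere (0 : X) 1 ∩ F := ⟨by simpa using hx, h⟩
    simp [he] at this
  · obtain ⟨y, ⟨hy1, hyF⟩, hmax⟩ :=
      hK.exists_isMaxOn hne (f := fun x => ‖T x‖) (by fun_prop)
    have hy1 : ‖y‖ = 1 := by simpa using hy1
    have hle : ‖T y‖ ≤ 1 := by simpa [hT, hy1] using T.le_opNorm y
    have hlt : ‖T y‖ < 1 := by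
      refine lt_of_le_of_ne hle fun h => ?_
      have := hyF y ⟨hy1, h.trans hT.symm⟩
      simp at this
      linarith
    refine ⟨1 - ‖T y‖, by linarith, fun x hx hxT => ?_⟩
    by_contra! h
    have := hmax (show x ∈ Metric.sphere (0 : X) 1 ∩ F from ⟨by simpa using hx, h⟩)
    simp only [Set.mem_ofPred_eq] at this
    linarith

theorem isUniformApprox_of_normAttainSet_eq [FiniteDimensional ℝ X] {T A : X →L[ℝ] Y} {ε : ℝ}
    (hT : ‖T‖ = 1) (hA : ‖A‖ = 1) (hM : normAttainSet T = normAttainSet A)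
    (hTA : ‖T - A‖ < ε) : IsUniformApprox ε T A := by
  obtain ⟨δ, hδ, h⟩ := exists_forall_near_normAttainSet T hT ((norm_nonneg _).trans_lt hTA)
  refine ⟨hT, hA, δ, hδ, fun x hx hxT => ?_⟩
  obtain ⟨u, hu, hux⟩ := h x hx hxT
  exact ⟨u, hM ▸ hu, hux, hTA⟩

end FiniteDimensional

/-- After squaring, both sides are double sums over `(j, k)` that compare term by term, so equality
of the sums forces equality of the terms. -/
theorem abs_sum_eq_sum_abs_iff_mul_nonneg {ι : Type*} (s : Finset ι) (a : ι → ℝ) :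
    |∑ j ∈ s, a j| = ∑ j ∈ s, |a j| ↔ ∀ j ∈ s, ∀ k ∈ s, 0 ≤ a j * a k := by
  have h0 : 0 ≤ ∑ j ∈ s, |a j| := Finset.sum_nonneg fun _ _ => abs_nonneg _
  rw [← sq_eq_sq₀ (abs_nonneg _) h0, sq_abs, sq, sq, Finset.sum_mul_sum, Finset.sum_mul_sum,
    Finset.sum_eq_sum_iff_of_le fun j _ => Finset.sum_le_sum fun k _ => by
      rw [← abs_mul]; exact le_abs_self _]
  refine forall₂_congr fun j _ => ?_
  rw [Finset.sum_eq_sum_iff_of_le fun k _ => by rw [← abs_mul]; exact le_abs_self _]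
  refine forall₂_congr fun k _ => ?_
  rw [← abs_mul, eq_comm, abs_eq_self]

theorem mul_nonneg_iff_of_sign_eq {a b : ℝ} (h : SignType.sign a = SignType.sign b) (c : ℝ) :
    0 ≤ a * c ↔ 0 ≤ b * c := by
  rw [← sign_nonneg_iff, sign_mul, h, ← sign_mul, sign_nonneg_iff]

/-! ### Columns and norm attainment on `ℓ₁ⁿ` -/

variable {n : ℕ}

/-- The `j`-th column of the matrix of `T`. -/
noncomputable def col (T : ellOne n →L[ℝ] ellOne n) (j : Fin n) : ellOne n :=
  T (PiLp.single 1 j 1)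

theorem norm_ellOne (x : ellOne n) : ‖x‖ = ∑ i, |x i| := by
  simp [PiLp.norm_eq_of_L1]

theorem sum_smul_single (x : ellOne n) : ∑ j, x j • PiLp.single 1 j (1 : ℝ) = x := by
  ext i
  simp [Pi.single_apply]

theorem apply_eq_sum_smul_col (T : ellOne n →L[ℝ] ellOne n) (x : ellOne n) :
    T x = ∑ j, x j • col T j := by
  conv_lhs => rw [← sum_smul_single x]
  simp [col]

theorem apply_apply_eq_sum (T : ellOne n →L[ℝ] ellOne n) (x : ellOne n) (i : Fin n) :
    T x i = ∑ j, col T j i * x j := by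
  rw [apply_eq_sum_smul_col]
  simp [mul_comm]

theorem norm_col_le (T : ellOne n →L[ℝ] ellOne n) (j : Fin n) : ‖col T j‖ ≤ ‖T‖ := by
  simpa [col, PiLp.norm_single] using T.le_opNorm (PiLp.single 1 j 1)

theorem opNorm_le_of_norm_col_le (T : ellOne n →L[ℝ] ellOne n) {C : ℝ} (hC : 0 ≤ C)
    (h : ∀ j, ‖col T j‖ ≤ C) : ‖T‖ ≤ C := by
  refine T.opNorm_le_bound hC fun x => ?_
  rw [apply_eq_sum_smul_col, norm_ellOne x, Finset.mul_sum]
  refine norm_sum_le_of_le _ fun j _ => ?_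
  rw [norm_smul, Real.norm_eq_abs, mul_comm]
  exact mul_le_mul_of_nonneg_right (h j) (abs_nonneg _)

theorem exists_norm_col_eq_one {T : ellOne n →L[ℝ] ellOne n} (hT : ‖T‖ = 1) :
    ∃ j, ‖col T j‖ = 1 := by
  rcases isEmpty_or_nonempty (Fin n) with h | h
  · have := opNorm_le_of_norm_col_le T le_rfl fun j => h.elim j
    linarith
  · obtain ⟨j, hj⟩ := Finite.exists_max fun j => ‖col T j‖
    exact ⟨j, le_antisymm (hT ▸ norm_col_le T j)
      (hT ▸ opNorm_le_of_norm_col_le T (norm_nonneg _) hj)⟩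

/-- A unit vector lies in the norm attainment set of a norm one operator on `ℓ₁ⁿ` iff it is
supported on the columns of norm one and no cancellation takes place in any row. -/
theorem mem_normAttainSet_iff {T : ellOne n →L[ℝ] ellOne n} (hT : ‖T‖ = 1) (x : ellOne n) :
    x ∈ normAttainSet T ↔ ‖x‖ = 1 ∧ (∀ j, x j ≠ 0 → ‖col T j‖ = 1) ∧
      ∀ i j k, 0 ≤ (col T j i * col T k i) * (x j * x k) := by
  have hrow : ∀ i ∈ Finset.univ, |T x i| ≤ ∑ j, |col T j i * x j| := fun i _ => by
    rw [apply_apply_eq_sum]; exact Finset.abs_sum_le_sum_abs _ _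
  have hswap : ∑ i, ∑ j, |col T j i * x j| = ∑ j, ‖col T j‖ * |x j| := by
    rw [Finset.sum_comm]
    simp_rw [abs_mul, ← Finset.sum_mul, norm_ellOne]
  have hcol : ∀ j ∈ Finset.univ, ‖col T j‖ * |x j| ≤ |x j| := fun j _ =>
    mul_le_of_le_one_left (abs_nonneg _) (hT ▸ norm_col_le T j)
  have key : ‖T x‖ = ‖x‖ ↔ (∀ i ∈ Finset.univ, |T x i| = ∑ j, |col T j i * x j|) ∧
      ∀ j ∈ Finset.univ, ‖col T j‖ * |x j| = |x j| := by
    rw [← Finset.sum_eq_sum_iff_of_le hrow, ← Finset.sum_eq_sum_iff_of_le hcol, hswap,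
      norm_ellOne, norm_ellOne]
    have h1 := Finset.sum_le_sum hrow
    have h2 := Finset.sum_le_sum hcol
    rw [hswap] at h1
    constructor
    · intro h
      constructor <;> linarith
    · rintro ⟨h, h'⟩
      linarith
  have hrow' : ∀ i, |T x i| = ∑ j, |col T j i * x j| ↔
      ∀ j k, 0 ≤ (col T j i * col T k i) * (x j * x k) := fun i => by
    rw [apply_apply_eq_sum, abs_sum_eq_sum_abs_iff_mul_nonneg]
    simp [mul_mul_mul_comm]
  have hcol' : ∀ j, ‖col T j‖ * |x j| = |x j| ↔ (x j ≠ 0 → ‖col T j‖ = 1) := fun j => by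
    by_cases hx : x j = 0 <;> simp [hx]
  simp only [Finset.mem_univ, true_imp_iff, hrow', hcol'] at key
  rw [normAttainSet, Set.mem_ofPred_eq, hT]
  refine and_congr_right fun hx => ?_
  rw [← hx, key, and_comm, hx]

/-! ### Perturbing one column -/

/-- Changing one column of a norm one operator without affecting the signs of the products of
entries in each row. -/
theorem exists_approx_of_col_add {T : ellOne n →L[ℝ] ellOne n} (hT : ‖T‖ = 1) {ε : ℝ}
    (j₀ : Fin n) (v : ellOne n) (hv : v ≠ 0) (hvε : ‖v‖ < ε) (hle : ‖col T j₀ + v‖ ≤ 1)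
    (hone : ‖col T j₀ + v‖ = 1 ↔ ‖col T j₀‖ = 1)
    (hsign : ‖col T j₀‖ = 1 → ∀ i k, k ≠ j₀ → SignType.sign (col T j₀ i * col T k i) =
      SignType.sign ((col T j₀ + v) i * col T k i)) :
    ∃ A, IsNontrivialUniformApprox ε T A ∧ normAttainSet T = normAttainSet A := by
  set B : ellOne n →L[ℝ] ellOne n :=
    (PiLp.proj (𝕜 := ℝ) 1 (fun _ : Fin n => ℝ) j₀).smulRight v with hB
  set A := T + B with hA
  have hsame : col A j₀ = col T j₀ + v := by simp [col, hA, hB]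
  have hother : ∀ j, j ≠ j₀ → col A j = col T j := fun j hj => by
    simp [col, hA, hB, hj.symm]
  have hiff : ∀ j, ‖col T j‖ = 1 ↔ ‖col A j‖ = 1 := fun j => by
    by_cases hj : j = j₀
    · rw [hj, hsame, hone]
    · rw [hother j hj]
  have hA1 : ‖A‖ = 1 := by
    apply le_antisymm
    · refine opNorm_le_of_norm_col_le A zero_le_one fun j => ?_
      by_cases hj : j = j₀
      · rwa [hj, hsame]
      · rw [hother j hj, ← hT]; exact norm_col_le T j
    · obtain ⟨j, hj⟩ := exists_norm_col_eq_one hT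
      rw [← (hiff j).1 hj]
      exact norm_col_le A j
  have hTA : ‖T - A‖ < ε := by
    have : T - A = -B := by rw [hA]; abel
    rw [this, norm_neg]
    refine lt_of_le_of_lt (B.opNorm_le_bound (norm_nonneg v) fun x => ?_) hvε
    simp only [hB, ContinuousLinearMap.smulRight_apply, norm_smul]
    rw [mul_comm]
    exact mul_le_mul_of_nonneg_left (PiLp.norm_apply_le x j₀) (norm_nonneg _)
  have hM : normAttainSet T = normAttainSet A := by
    ext x
    rw [mem_normAttainSet_iff hT, mem_normAttainSet_iff hA1]
    simp_rw [← hiff]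
    refine and_congr_right fun _ => and_congr_right fun hx => ?_
    refine forall_congr' fun i => forall₂_congr fun j k => ?_
    by_cases hj : j = j₀ <;> by_cases hk : k = j₀
    · subst hj hk
      exact iff_of_true (mul_nonneg (mul_self_nonneg _) (mul_self_nonneg _))
        (mul_nonneg (mul_self_nonneg _) (mul_self_nonneg _))
    · subst hj
      by_cases hx0 : x j = 0
      · simp [hx0]
      · rw [hsame, hother k hk]
        exact mul_nonneg_iff_of_sign_eq (hsign (hx j hx0) i k hk) _
    · subst hk
      by_cases hx0 : x k = 0
      · simp [hx0]
      · rw [hsame, hother j hj, mul_comm (col T j i), mul_comm (col T j i)]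
        exact mul_nonneg_iff_of_sign_eq (hsign (hx k hx0) i j hj) _
    · rw [hother j hj, hother k hk]
  refine ⟨A, ⟨isUniformApprox_of_normAttainSet_eq hT hA1 hM hTA, fun h => hv ?_⟩, hM⟩
  simpa [h] using hsame

/-- Norm attaining vectors vanish at the coordinate of a short column, so lengthening it while its
norm stays below one imposes no sign condition. -/
theorem exists_approx_of_norm_col_lt {T : ellOne n →L[ℝ] ellOne n} (hT : ‖T‖ = 1) {ε : ℝ}
    (hε : 0 < ε) (j : Fin n) (hj : ‖col T j‖ < 1) :
    ∃ A, IsNontrivialUniformApprox ε T A ∧ normAttainSet T = normAttainSet A := by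
  obtain ⟨η, hη, hη'⟩ := exists_between (lt_min hε (sub_pos.2 hj))
  rw [lt_min_iff] at hη'
  have hv : ‖(PiLp.single 1 j η : ellOne n)‖ = η := by rw [PiLp.norm_single, Real.norm_of_nonneg hη.le]
  have hlt : ‖col T j + PiLp.single 1 j η‖ < 1 := by
    have := norm_add_le (col T j) (PiLp.single 1 j η)
    linarith
  exact exists_approx_of_col_add hT j (PiLp.single 1 j η) (norm_pos_iff.1 (hv.symm ▸ hη))
    (by linarith) hlt.le (iff_of_false hlt.ne hj.ne) fun h => absurd h hj.ne

theorem abs_combo_of_mul_nonneg {p q a b : ℝ} (hp : 0 ≤ p) (hq : 0 ≤ q) (hab : 0 ≤ a * b) :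
    |p * a + q * b| = p * |a| + q * |b| := by
  have h : |p * a + q * b| = |p * a| + |q * b| := by
    rw [abs_add_eq_add_abs_iff]
    rcases mul_nonneg_iff.1 hab with ⟨ha, hb⟩ | ⟨ha, hb⟩
    · exact Or.inl ⟨mul_nonneg hp ha, mul_nonneg hq hb⟩
    · exact Or.inr ⟨mul_nonpos_of_nonneg_of_nonpos hp ha, mul_nonpos_of_nonneg_of_nonpos hq hb⟩
  rw [h, abs_mul, abs_mul, abs_of_nonneg hp, abs_of_nonneg hq]

/-- Moving a column of norm one towards a signed unit vector. -/
theorem exists_approx_of_col_ne_single {T : ellOne n →L[ℝ] ellOne n} (hT : ‖T‖ = 1) {ε : ℝ}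
    (hε : 0 < ε) (j l : Fin n) (s : ℝ) (hj : ‖col T j‖ = 1) (hs : |s| = 1)
    (hne : col T j ≠ PiLp.single 1 l s) (hsl : 0 ≤ s * col T j l)
    (hl : 0 < s * col T j l ∨ ∀ k, k ≠ j → col T k l = 0) :
    ∃ A, IsNontrivialUniformApprox ε T A ∧ normAttainSet T = normAttainSet A := by
  -- Two vectors of norm one are at distance at most 2, hence `ε / 2`; `η < 1` keeps the old entries
  -- with positive weight.
  obtain ⟨η, hη, hη'⟩ := exists_between (lt_min (half_pos hε) one_pos)
  rw [lt_min_iff] at hη'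
  have h1η : 0 < 1 - η := sub_pos.2 hη'.2
  obtain ⟨w, hw⟩ : ∃ w : ellOne n, w = PiLp.single 1 l s := ⟨_, rfl⟩
  have hwl : w l = s := by rw [hw, PiLp.single_eq_same]
  have hwi : ∀ i, i ≠ l → w i = 0 := fun i hi => by rw [hw, PiLp.single_eq_of_ne _ hi]
  have hw1 : ‖w‖ = 1 := by rw [hw, PiLp.norm_single, Real.norm_eq_abs, hs]
  rw [← hw] at hne
  have hcomb : ∀ i, (col T j + η • (w - col T j)) i = (1 - η) * col T j i + η * w i :=
    fun i => by
      simp only [PiLp.add_apply, PiLp.smul_apply, PiLp.sub_apply, smul_eq_mul]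
      ring
  have hnorm : ‖col T j + η • (w - col T j)‖ = 1 := by
    have habs : ∀ i, |(col T j + η • (w - col T j)) i| = (1 - η) * |col T j i| + η * |w i| :=
      fun i => by
        rw [hcomb]
        refine abs_combo_of_mul_nonneg h1η.le hη.le ?_
        by_cases hi : i = l
        · rw [hi, hwl, mul_comm]; exact hsl
        · simp [hwi i hi]
    rw [norm_ellOne, Finset.sum_congr rfl fun i _ => habs i, Finset.sum_add_distrib,
      ← Finset.mul_sum, ← Finset.mul_sum, ← norm_ellOne, ← norm_ellOne, hj, hw1]
    ring
  refine exists_approx_of_col_add hT j (η • (w - col T j))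
    (smul_ne_zero hη.ne' (sub_ne_zero.2 hne.symm)) ?_ hnorm.le (iff_of_true hnorm hj)
    fun _ i k hk => ?_
  · rw [norm_smul, Real.norm_of_nonneg hη.le]
    have := norm_sub_le w (col T j)
    nlinarith
  · by_cases hi : i = l
    · subst hi
      rcases hl with hl | hl
      · rw [sign_mul, sign_mul]
        congr 1
        rw [hcomb, hwl]
        rcases pos_and_pos_or_neg_and_neg_of_mul_pos hl with ⟨h, h'⟩ | ⟨h, h'⟩
        · rw [sign_pos h', sign_pos (add_pos (mul_pos h1η h') (mul_pos hη h))]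
        · rw [sign_neg h', sign_neg (add_neg (mul_neg_of_pos_of_neg h1η h')
            (mul_neg_of_pos_of_neg hη h))]
      · simp [hl k hk]
    · rw [hcomb, hwi i hi, mul_zero, add_zero, mul_assoc, sign_mul (1 - η), sign_pos h1η, one_mul]

/-- A signed permutation of the coordinates is an isometry of `ℓ₁ⁿ`. -/
theorem isometry_of_col_eq_single {T : ellOne n →L[ℝ] ellOne n} {p : Fin n → Fin n}
    (hp : Function.Injective p) {s : Fin n → ℝ} (hs : ∀ j, |s j| = 1)
    (h : ∀ j, col T j = PiLp.single 1 (p j) (s j)) : Isometry T := by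
  refine AddMonoidHomClass.isometry_of_norm T fun x => ?_
  rw [norm_ellOne, norm_ellOne, ← (Finite.injective_iff_bijective.1 hp).sum_comp]
  refine Finset.sum_congr rfl fun k _ => ?_
  rw [apply_apply_eq_sum, Finset.sum_eq_single k]
  · rw [h, PiLp.single_eq_same, abs_mul, hs, one_mul]
  · intro j _ hj
    rw [h, PiLp.single_eq_of_ne _ (hp.ne hj.symm), zero_mul]
  · simp

theorem hasNontrivialNormPreservingApprox_ellOne (n : ℕ) :
    HasNontrivialNormPreservingApprox (ellOne n) (ellOne n) := by
  intro T hT hiso ε hε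
  by_contra hno
  have hone : ∀ j, ‖col T j‖ = 1 := fun j => by
    by_contra h
    exact hno (exists_approx_of_norm_col_lt hT hε j (lt_of_le_of_ne (hT ▸ norm_col_le T j) h))
  have hex : ∀ j, ∃ i, col T j i ≠ 0 := fun j => by
    by_contra! h
    have := hone j
    simp [norm_ellOne, h] at this
  choose p hp using hex
  have hs : ∀ j, |(SignType.sign (col T j (p j)) : ℝ)| = 1 := fun j => by
    rcases lt_or_gt_of_ne (hp j) with h | h <;> simp [h]
  have hcol : ∀ j, col T j = PiLp.single 1 (p j) (SignType.sign (col T j (p j)) : ℝ) := fun j => by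
    by_contra h
    have hpos : 0 < (SignType.sign (col T j (p j)) : ℝ) * col T j (p j) := by
      rw [sign_mul_self]; exact abs_pos.2 (hp j)
    exact hno (exists_approx_of_col_ne_single hT hε j (p j) _ (hone j) (hs j) h hpos.le
      (Or.inl hpos))
  by_cases hinj : Function.Injective p
  · exact hiso (isometry_of_col_eq_single hinj hs hcol)
  -- A self-map of `Fin n` that is not injective misses some `l`; row `l` is then zero, and its
  -- products of entries of two distinct columns stay zero when one column changes.
  · rw [Finite.injective_iff_surjective, Function.Surjective] at hinj
    push Not at hinj
    obtain ⟨l, hl⟩ := hinj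
    have hzero : ∀ k, col T k l = 0 := fun k => by
      rw [hcol k, PiLp.single_eq_of_ne _ (hl k).symm]
    obtain ⟨j, -⟩ := exists_norm_col_eq_one hT
    refine hno (exists_approx_of_col_ne_single hT hε j l 1 (hone j) abs_one (fun h => ?_)
      (by simp [hzero]) (Or.inr fun k _ => hzero k))
    have := hzero j
    rw [h] at this
    simp at this

/-! ### Rigidity of isometries -/

/-- Uniform approximations of an isometry of `ℓ₁ⁿ` have columns of norm one with pairwise disjoint
supports. -/
theorem IsUniformApprox.disjoint_col {T A : ellOne n →L[ℝ] ellOne n} (hT : Isometry T) {ε : ℝ}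
    (hε : ε * n ≤ 1) (h : IsUniformApprox ε T A) :
    (∀ j, ‖col A j‖ = 1) ∧ ∀ i j k, j ≠ k → col A j i * col A k i = 0 := by
  obtain ⟨-, hA, δ, hδ, h⟩ := h
  have key : ∀ σ : Fin n → ℝ, (∀ j, |σ j| = 1) → (∀ j, ‖col A j‖ = 1) ∧
      ∀ i j k, 0 ≤ (col A j i * col A k i) * (σ j * σ k) := by
    intro σ hσ
    rcases Nat.eq_zero_or_pos n with rfl | hn
    · exact ⟨fun j => j.elim0, fun i => i.elim0⟩
    have hn' : (0 : ℝ) < n := Nat.cast_pos.2 hn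
    -- All coordinates of this vector have modulus `1 / n ≥ ε`, so a norm attaining vector of `A`
    -- within `ε` of it has exactly the signs `σ`.
    have hx : ‖(WithLp.toLp 1 fun j => σ j / n : ellOne n)‖ = 1 := by
      simp [norm_ellOne, abs_div, hσ, hn'.ne']
    obtain ⟨u, hu, hux, -⟩ := h _ hx (by
      rw [(AddMonoidHomClass.isometry_iff_norm T).1 hT, hx]; linarith)
    obtain ⟨-, hu1, hu2⟩ := (mem_normAttainSet_iff hA u).1 hu
    have hpos : ∀ j, 0 < σ j * u j := fun j => by
      have h1 : |u j - σ j / n| < 1 / n := by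
        have := PiLp.norm_apply_le (u - WithLp.toLp 1 fun j => σ j / n) j
        simp only [PiLp.sub_apply, Real.norm_eq_abs] at this
        exact (this.trans_lt hux).trans_le ((le_div_iff₀ hn').2 hε)
      rw [abs_lt] at h1
      rcases eq_or_eq_neg_of_abs_eq (hσ j) with h2 | h2 <;> rw [h2] at h1 ⊢
      · linarith [h1.1]
      · have := h1.2
        rw [neg_div] at this
        linarith
    refine ⟨fun j => hu1 j fun h0 => ?_, fun i j k => ?_⟩
    · have := hpos j
      simp [h0] at this
    · have h3 := mul_pos (hpos j) (hpos k)
      have h4 := mul_nonneg (hu2 i j k) h3.le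
      have h5 : 0 < (u j * u k) ^ 2 := by
        refine sq_pos_of_ne_zero (mul_ne_zero ?_ ?_) <;> intro h0 <;> simp [h0] at h3
      refine nonneg_of_mul_nonneg_left (b := (u j * u k) ^ 2) ?_ h5
      linarith
  have h1 := key (fun _ => 1) (by simp)
  refine ⟨h1.1, fun i j k hjk => le_antisymm ?_ (by simpa using h1.2 i j k)⟩
  -- Flipping the sign at `k` alone reverses the inequality given by constant signs.
  have := (key (fun m => if m = k then -1 else 1) (fun m => by split_ifs <;> simp)).2 i j k
  simpa [hjk] using this

/-- Since `n` nonzero columns with disjoint supports share `n` rows, each has a single nonzero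
entry, which is `±1` by the norm condition. -/
theorem exists_int_eq_entry_of_disjoint_col {T : ellOne n →L[ℝ] ellOne n} (hone : ∀ j, ‖col T j‖ = 1)
    (hdisj : ∀ i j k, j ≠ k → col T j i * col T k i = 0) (i j : Fin n) :
    ∃ m : ℤ, col T j i = m := by
  have hex : ∀ j, ∃ i, col T j i ≠ 0 := fun j => by
    by_contra! h
    have := hone j
    simp [norm_ellOne, h] at this
  choose p hp using hex
  have hinj : Function.Injective p := fun j k hjk => by
    by_contra hne
    refine mul_ne_zero (hp j) ?_ (hdisj (p j) j k hne)
    rw [hjk]; exact hp k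
  have hzero : ∀ i, i ≠ p j → col T j i = 0 := fun i hi => by
    obtain ⟨k, rfl⟩ := Finite.surjective_of_injective hinj i
    have hkj : k ≠ j := fun h => hi (h ▸ rfl)
    exact (mul_eq_zero.1 (hdisj (p k) k j hkj)).resolve_left (hp k)
  by_cases hi : i = p j
  · have := hone j
    rw [norm_ellOne, Finset.sum_eq_single (p j) (fun i _ hi => by simp [hzero i hi]) (by simp),
      ← hi] at this
    rcases eq_or_eq_neg_of_abs_eq this with h | h
    · exact ⟨1, by simp [h]⟩
    · exact ⟨-1, by simp [h]⟩
  · exact ⟨0, by simp [hzero i hi]⟩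

theorem isOnlyUniformApprox_of_isometry {T : ellOne n →L[ℝ] ellOne n} (hT : ‖T‖ = 1)
    (hiso : Isometry T) {ε : ℝ} (hε : 0 < ε) (hε1 : ε ≤ 1) (hεn : ε * n ≤ 1) :
    IsOnlyUniformApprox ε T := by
  have hself : IsUniformApprox ε T T :=
    isUniformApprox_of_normAttainSet_eq hT hT rfl (by simpa using hε)
  refine fun A => ⟨fun hA => ?_, fun h => h ▸ hself⟩
  obtain ⟨hT1, hT2⟩ := hself.disjoint_col hiso hεn
  obtain ⟨hA1, hA2⟩ := hA.disjoint_col hiso hεn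
  obtain ⟨j₀, -⟩ := exists_norm_col_eq_one hT
  have hTA : ‖T - A‖ < 1 := by
    obtain ⟨-, -, δ, hδ, h⟩ := hA
    obtain ⟨u, -, -, hu⟩ := h (PiLp.single 1 j₀ 1) (by simp [PiLp.norm_single]) (by
      change _ < ‖col T j₀‖
      rw [hT1]; linarith)
    exact hu.trans_le hε1
  have hcol : ∀ j, col A j = col T j := fun j => by
    ext i
    obtain ⟨a, ha⟩ := exists_int_eq_entry_of_disjoint_col hA1 hA2 i j
    obtain ⟨t, ht⟩ := exists_int_eq_entry_of_disjoint_col hT1 hT2 i j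
    have hlt : |col T j i - col A j i| < 1 :=
      ((PiLp.norm_apply_le (col (T - A) j) i).trans (norm_col_le (T - A) j)).trans_lt hTA
    rw [ha, ht] at hlt ⊢
    have : |t - a| < 1 := by
      rw [← Int.cast_sub, ← Int.cast_abs] at hlt
      exact Int.cast_lt.1 (hlt.trans_eq Int.cast_one.symm)
    rw [Int.abs_lt_one_iff, sub_eq_zero] at this
    rw [this]
  ext1 x
  rw [apply_eq_sum_smul_col, apply_eq_sum_smul_col T]
  simp_rw [hcol]

end BPB

theorem mainTheorem8 (n : ℕ) :
    (∀ T : BPB.ellOne n →L[ℝ] BPB.ellOne n, ‖T‖ = 1 →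
      (Isometry T ↔ ∃ ε₀ : ℝ, 0 < ε₀ ∧
        ∀ ε : ℝ, 0 < ε → ε < ε₀ → BPB.IsOnlyUniformApprox ε T)) ∧
    BPB.HasNontrivialNormPreservingApprox (BPB.ellOne n) (BPB.ellOne n) := by
  refine ⟨fun T hT => ⟨fun hiso => ?_, ?_⟩, BPB.hasNontrivialNormPreservingApprox_ellOne n⟩
  · have hn : (0 : ℝ) < n + 1 := by positivity
    -- The bound `ε (n + 1) < 1` gives both `ε ≤ 1` and `ε n ≤ 1`, and also makes sense for `n = 0`.
    refine ⟨1 / (n + 1), by positivity, fun ε hε hlt => ?_⟩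
    rw [lt_div_iff₀ hn] at hlt
    have hεn : 0 ≤ ε * n := by positivity
    exact BPB.isOnlyUniformApprox_of_isometry hT hiso hε (by linarith) (by linarith)
  · rintro ⟨ε₀, hε₀, h⟩
    by_contra hiso
    obtain ⟨A, ⟨hA, hne⟩, -⟩ := BPB.hasNontrivialNormPreservingApprox_ellOne n T hT hiso
      (ε₀ / 2) (half_pos hε₀)
    exact hne ((h (ε₀ / 2) (half_pos hε₀) (half_lt_self hε₀) A).1 hA)
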